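/- Let $F=\mathbb{Q}(i)$ or $F=\mathbb{Q}(j)$ with $j=e^{2\pi i/3}$, and let $\mathbb{Q}(\theta)$ be a totally real Galois number field of degree $n$ whose (absolute) discriminant $d_{\mathbb{Q}(\theta)}$ is coprime to the discriminant of $F$. Let $K=F\mathbb{Q}(\theta)\subset\mathbb{C}$ be the compositum, and assume that $K/F$ is cyclic of degree $n$ with Galois group generated by $\sigma$. Let $\gamma\in\mathcal{O}_F$, $\gamma\neq 0$, be such that the cyclic algebra $$\mathcal{A}=(K/F,\sigma,\gamma)=1\cdot K\oplus e\cdot K\oplus\dots\oplus e^{n-1}\cdot K,\qquad l\,e=e\,\sigma(l)\ (l\in K),\quad e^n=\gamma,$$ is a division algebra. Let $\mathcal{I}$ be a principal ideal of $\mathcal{O}_K$, let $c>0$ be a real normalisation constant, and let $\mathcal{C}_{\mathcal{I}}$ be the infinite code consisting of the matrices $$\frac{1}{\sqrt{c}}\begin{pmatrix} x_0 & x_1 & \cdots & x_{n-1}\\ \gamma\sigma(x_{n-1}) & \sigma(x_0) & \cdots & \sigma(x_{n-2})\\ \vdots & & & \vdots\\ \gamma\sigma^{n-1}(x_1) & \gamma\sigma^{n-1}(x_2)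 & \cdots & \sigma^{n-1}(x_0)\end{pmatrix},\qquad x_0,\dots,x_{n-1}\in\mathcal{I}.$$ For a set $\mathcal{C}$ of complex $n\times n$ matrices, its minimum determinant is $\delta_{\min}(\mathcal{C})=\inf_{0\ne X\in\mathcal{C}}|\det X|^2$. Assume that $\mathcal{C}_{\mathcal{I}}$ is a perfect code, that is, there are complex $n\times n$ matrices $R_0,\dots,R_{n-1}$ such that: 1. (full rate) $\mathcal{C}_{\mathcal{I}}$ is the set of all matrices $X(u)$, for arrays of $n^2$ information symbols $u=(u_{l,k})_{0\le l,k\le n-1}$ in $\mathcal{O}_F$, where $X(u)$ has the entries $X(u)_{i,\,i+l \bmod n}=\sum_{k}(R_l)_{i,k}\,u_{l,k}$ (so that the $l$-th layer of $X(u)$ is the vector $R_l u_l$); 2. $\delta_{\min}(\mathcal{C}_{\mathcal{I}})\neq 0$; 3. (shaping) every $R_l$ is unitary; 4. (uniform average energy) for every nonempty finite set $S\subset\mathcal{O}_F$ with $\sum_{s\in S}s=0$, the average of $|X(u)_{i,j}|^2$ over all $u$ with all entries in $S$ is the same for all positions $(i,j)$. Then the minimum determinant of $\mathcal{C}_{\mathcal{I}}$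 is attained, and $$\delta_{\min}(\mathcal{C}_{\mathcal{I}})=\min_{0\neq X\in\mathcal{C}_{\mathcal{I}}}|\det X|^2=\frac{1}{d_{\mathbb{Q}(\theta)}}.$$ -/

import Mathlib

open Matrix NumberField
open scoped IntermediateField

/-- The set of values `|det X|²`, for `X` running through the nonzero codewords of `C`. -/
def codeDetValues {n : ℕ} (C : Set (Matrix (Fin n) (Fin n) ℂ)) : Set ℝ :=
  {r | ∃ X ∈ C, X ≠ 0 ∧ r = ‖X.det‖ ^ 2}

/-- The minimum determinant `δ_min(C)` of a code. -/
noncomputable def minDeterminant {n : ℕ} (C : Set (Matrix (Fin n) (Fin n) ℂ)) : ℝ :=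
  sInf (codeDetValues C)

/-- Layered linear dispersion encoder with `n²` information symbols `u l k`.
The `l`-th layer of a square matrix consists of the entries `(i, i + l)`, indices modulo `n`;
it carries the vector `R l *ᵥ u l`. -/
def layeredEncode {n : ℕ} (R : Fin n → Matrix (Fin n) (Fin n) ℂ) (u : Fin n → Fin n → ℂ) :
    Matrix (Fin n) (Fin n) ℂ :=
  Matrix.of fun i j => (R (j - i) *ᵥ u (j - i)) i

/-- The average energy of the coded symbol at position `(i, j)` when the `n²` information symbols
are chosen independently and uniformly in the finite constellation `S`. -/
noncomputable def averageEnergy {n : ℕ} (R : Fin n → Matrix (Fin n) (Fin n) ℂ) (S : Finset ℂ)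
    (i j : Fin n) : ℝ :=
  (∑ u ∈ Fintype.piFinset fun _ : Fin n => Fintype.piFinset fun _ : Fin n => S,
      ‖layeredEncode R u i j‖ ^ 2) / (S.card : ℝ) ^ (n ^ 2)

/-- `C` is (the infinite code of) a perfect `n × n` space-time block code with information symbols
in `Λ`: QAM symbols for `Λ = ℤ[i]`, HEX symbols for `Λ = ℤ[j]`. -/
def IsPerfectCode {n : ℕ} (Λ : Set ℂ) (C : Set (Matrix (Fin n) (Fin n) ℂ)) : Prop :=
  ∃ R : Fin n → Matrix (Fin n) (Fin n) ℂ,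
    -- full rate linear dispersion code with `n²` information symbols
    (C = {X | ∃ u : Fin n → Fin n → ℂ, (∀ l k, u l k ∈ Λ) ∧ X = layeredEncode R u}) ∧
    -- the minimum determinant of the infinite code is nonzero
    minDeterminant C ≠ 0 ∧
    -- shaping: every layer is encoded by a unitary matrix
    (∀ l, R l ∈ Matrix.unitaryGroup (Fin n) ℂ) ∧
    -- all coded symbols have the same average energy, for every balanced finite constellation
    (∀ S : Finset ℂ, S.Nonempty → (∀ s ∈ S, s ∈ Λ) → ∑ s ∈ S, s = 0 →
      ∀ i j i' j', averageEnergy R S i j = averageEnergy R S i' j')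

section CyclicAlgebra

variable {F K : Type*} [Field F] [Field K] [Algebra F K]

/-- The cyclic algebra `(K/F, σ, γ) = 1·K ⊕ e·K ⊕ ⋯ ⊕ eⁿ⁻¹·K`, where `n = [K : F]`,
`l e = e σ(l)` for `l ∈ K`, and `eⁿ = γ`.  The family `x` stands for
`x₀ + e x₁ + ⋯ + eⁿ⁻¹ xₙ₋₁`. -/
@[nolint unusedArguments]
def CyclicAlgebra (_σ : K ≃ₐ[F] K) (_γ : F) : Type _ := Fin (Module.finrank F K) → K

namespace CyclicAlgebra

variable {σ : K ≃ₐ[F] K} {γ : F}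

instance : AddCommGroup (CyclicAlgebra σ γ) :=
  inferInstanceAs (AddCommGroup (Fin (Module.finrank F K) → K))

@[ext] theorem ext {x y : CyclicAlgebra σ γ} (h : ∀ k, x k = y k) : x = y := funext h

theorem add_apply (x y : CyclicAlgebra σ γ) (k : Fin (Module.finrank F K)) :
    (x + y) k = x k + y k := rfl

theorem zero_apply (k : Fin (Module.finrank F K)) : (0 : CyclicAlgebra σ γ) k = 0 := rfl

instance : One (CyclicAlgebra σ γ) := ⟨fun k => if (k : ℕ) = 0 then 1 else 0⟩

/-- Since `(eᵃ x) (eᵇ y) = eᵃ⁺ᵇ σᵇ(x) y`, the coefficient of `eᵏ` in a product collects the terms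
with `a + b = k` and, with a factor `γ = eⁿ`, those with `a + b = k + n`. -/
noncomputable instance : Mul (CyclicAlgebra σ γ) :=
  ⟨fun x y k => ∑ b, (if k < b then algebraMap F K γ else 1) * (σ ^ (b : ℕ)) (x (k - b)) * y b⟩

theorem one_apply (k : Fin (Module.finrank F K)) :
    (1 : CyclicAlgebra σ γ) k = if (k : ℕ) = 0 then 1 else 0 := rfl

theorem mul_apply (x y : CyclicAlgebra σ γ) (k : Fin (Module.finrank F K)) :
    (x * y) k =
      ∑ b, (if k < b then algebraMap F K γ else 1) * (σ ^ (b : ℕ)) (x (k - b)) * y b := rfl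

theorem twist_assoc (g : K) (k b c : Fin (Module.finrank F K)) :
    (if k < c then g else 1) * (if k - c < b then g else 1) =
      (if k < b + c then g else 1) * (if b + c < c then g else 1) := by
  have hk := k.isLt
  have hb := b.isLt
  have hc := c.isLt
  simp only [Fin.lt_def, Fin.sub_def, Fin.val_add]
  generalize Module.finrank F K = n at *
  have h1 : ((n - (c : ℕ)) + k) % n = if (k : ℕ) < c then n - c + k else k - c := by
    split_ifs with h
    · exact Nat.mod_eq_of_lt (by omega)
    · rw [show n - (c : ℕ) + k = (k - c) + n by omega, Nat.add_mod_right,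
        Nat.mod_eq_of_lt (by omega)]
  have h2 : ((b : ℕ) + c) % n = if (b : ℕ) + c < n then (b : ℕ) + c else b + c - n := by
    split_ifs with h
    · exact Nat.mod_eq_of_lt (by omega)
    · rw [Nat.mod_eq_sub_mod (by omega), Nat.mod_eq_of_lt (by omega)]
  rw [h1, h2]
  split_ifs <;> first | rfl | omega | simp

variable [FiniteDimensional F K] [IsGalois F K]

theorem pow_finrank_eq_one : σ ^ Module.finrank F K = 1 := by
  rw [← IsGalois.card_aut_eq_finrank]; exact pow_card_eq_one'

theorem pow_add_fin (b c : Fin (Module.finrank F K)) :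
    σ ^ (((b + c : Fin (Module.finrank F K))) : ℕ) = σ ^ (c : ℕ) * σ ^ (b : ℕ) := by
  rw [← pow_add, Fin.val_add, add_comm (c : ℕ)]
  conv_rhs => rw [← Nat.mod_add_div ((b : ℕ) + c) (Module.finrank F K), pow_add, pow_mul,
    pow_finrank_eq_one, one_pow, mul_one]

noncomputable instance : Ring (CyclicAlgebra σ γ) :=
  { (inferInstance : AddCommGroup (CyclicAlgebra σ γ)),
    (inferInstance : One (CyclicAlgebra σ γ)),
    (inferInstance : Mul (CyclicAlgebra σ γ)) with
    left_distrib := fun x y z => by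
      ext k
      simp only [mul_apply, add_apply, mul_add, Finset.sum_add_distrib]
    right_distrib := fun x y z => by
      ext k
      simp only [mul_apply, add_apply, map_add, mul_add, add_mul, Finset.sum_add_distrib]
    zero_mul := fun x => by
      ext k
      simp [mul_apply, zero_apply]
    mul_zero := fun x => by
      ext k
      simp [mul_apply, zero_apply]
    one_mul := fun x => by
      have : NeZero (Module.finrank F K) := ⟨Module.finrank_pos.ne'⟩
      ext k
      rw [mul_apply, Finset.sum_eq_single k]
      · simp [one_apply]
      · intro b _ hb
        have : ((k - b : Fin (Module.finrank F K)) : ℕ) ≠ 0 := fun h =>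
          hb (sub_eq_zero.mp (Fin.ext (by simpa using h))).symm
        simp [one_apply, this]
      · simp
    mul_one := fun x => by
      have : NeZero (Module.finrank F K) := ⟨Module.finrank_pos.ne'⟩
      ext k
      rw [mul_apply, Finset.sum_eq_single 0]
      · simp [one_apply]
      · intro b _ hb
        have : (b : ℕ) ≠ 0 := fun h => hb (Fin.ext (by simpa using h))
        simp [one_apply, this]
      · simp
    mul_assoc := fun x y z => by
      have : NeZero (Module.finrank F K) := ⟨Module.finrank_pos.ne'⟩
      ext k
      simp only [mul_apply, map_sum, map_mul, Finset.sum_mul, Finset.mul_sum]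
      conv_rhs => rw [Finset.sum_comm]
      refine Finset.sum_congr rfl fun c _ => ?_
      conv_rhs => rw [← Equiv.sum_comp (Equiv.addRight c)]
      refine Finset.sum_congr rfl fun b _ => ?_
      have h := twist_assoc (F := F) (algebraMap F K γ) k b c
      rw [show (Equiv.addRight c) b = b + c from rfl]
      simp only [add_sub_cancel_right, pow_add_fin, AlgEquiv.mul_apply,
        show k - (b + c) = k - c - b by abel]
      rw [apply_ite (σ ^ (c : ℕ)), AlgEquiv.commutes, map_one]
      linear_combination (σ ^ (c : ℕ)) ((σ ^ (b : ℕ)) (x (k - c - b))) *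
        (σ ^ (c : ℕ)) (y b) * z c * h }

end CyclicAlgebra

/-- The codeword with first row `x₀, …, xₙ₋₁`: its entry `(i, j)` is `σⁱ(xⱼ₋ᵢ)` for `i ≤ j`
and `γ σⁱ(xₙ₊ⱼ₋ᵢ)` for `j < i`. -/
def cyclicCodeword {n : ℕ} (σ : K ≃ₐ[F] K) (γ : F) (x : Fin n → K) : Matrix (Fin n) (Fin n) K :=
  Matrix.of fun i j => (if j < i then algebraMap F K γ else 1) * (σ ^ (i : ℕ)) (x (j - i))

/-- The infinite code `C_I`, whose codewords have first row in the ideal `I` of `𝓞 K`,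
multiplied by the real normalisation factor `1 / √c`.  Here `ι` is the inclusion `K ⊂ ℂ`. -/
def cyclicCode (n : ℕ) (ι : K →+* ℂ) (σ : K ≃ₐ[F] K) (γ : F) (I : Ideal (𝓞 K)) (c : ℝ) :
    Set (Matrix (Fin n) (Fin n) ℂ) :=
  {X | ∃ x : Fin n → 𝓞 K, (∀ l, x l ∈ I) ∧
    X = ((1 / Real.sqrt c : ℝ) : ℂ) • (cyclicCodeword σ γ fun l => (x l : K)).map ι}

end CyclicAlgebra

/-! ### Codeword determinants: nonvanishing, descent to `F`, integrality. -/

section CyclicCodeword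

variable {F K : Type*} [Field F] [Field K] [Algebra F K]

/-! Let `s = 1/√c`, `I = (α)`, `N = ∏ σⁱ(α)`. A codeword with first row `α y` has determinant `sⁿ N
z`, where `z` is the determinant of the codeword matrix of `y`. That matrix represents left
multiplication by `y` in a division algebra, so `z ≠ 0` for `y ≠ 0`. Moreover `z` is fixed by `σ`
and integral, so it lies in `𝓞 F` and `|z| ≥ 1`, as `F` is imaginary quadratic. The minimum is
therefore `|sⁿ N|²`, attained at first row `(α, 0, …, 0)`.

Shaping fixes this constant. Let `b` be an integral basis of `ℚ(θ)`; by coprimality of the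
discriminants it is also an `𝓞 F`-basis of `𝓞 K`, and its matrix `V` of conjugates satisfies `det V
² = d`. The columns of `R 0` and those of `s` times the conjugates of `α b` are integral
combinations of each other, so their determinants have equal modulus, namely 1 by unitarity. Hence
`|sⁿ N|² d = 1` (`normalization_of_unitary`). -/

theorem CyclicAlgebra.mul_eq_vecMul {σ : K ≃ₐ[F] K} {γ : F} (x v : CyclicAlgebra σ γ) :
    (x * v : CyclicAlgebra σ γ) =
      Matrix.vecMul (fun k => v k) (cyclicCodeword σ γ fun k => x k) := by
  funext k
  rw [CyclicAlgebra.mul_apply]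
  exact Finset.sum_congr rfl fun b _ => mul_comm _ _

/-- A nonzero kernel vector `v` of the matrix would satisfy `x * v = 0`, impossible for a unit `x`.
-/
theorem det_cyclicCodeword_ne_zero [FiniteDimensional F K] [IsGalois F K] {σ : K ≃ₐ[F] K} {γ : F}
    {x : CyclicAlgebra σ γ} (hx : IsUnit x) : (cyclicCodeword σ γ fun k => x k).det ≠ 0 := by
  intro h
  obtain ⟨v, hv, hv0⟩ := Matrix.exists_vecMul_eq_zero_iff.mpr h
  let v' : CyclicAlgebra σ γ := v
  have h0 : x * v' = 0 := by
    rw [CyclicAlgebra.mul_eq_vecMul]; exact hv0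
  exact hv ((hx.mul_right_eq_zero).mp h0)

variable {n : ℕ}

/-- Applying `σ` to all entries amounts to shifting rows and columns cyclically and conjugating by a
diagonal matrix; neither changes the determinant. -/
theorem map_det_cyclicCodeword [NeZero n] {σ : K ≃ₐ[F] K} (hσ : σ ^ n = 1) {γ : F} (hγ : γ ≠ 0)
    (x : Fin n → K) : σ (cyclicCodeword σ γ x).det = (cyclicCodeword σ γ x).det := by
  have hγ' : algebraMap F K γ ≠ 0 := by simpa using hγ
  set M := cyclicCodeword σ γ x
  -- The factor `γ` sits at the last index only, where `i + 1` wraps around to `0`.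
  let d : Fin n → K := fun i => if i + 1 = 0 then algebraMap F K γ else 1
  have hd : (Matrix.diagonal d).det ≠ 0 := by
    rw [Matrix.det_diagonal, Finset.prod_ne_zero_iff]
    intro i _
    simp only [d]
    split_ifs <;> simp [hγ']
  have hwrap (i : Fin n) : (i + 1 = 0 ∧ (i : ℕ) + 1 = n) ∨
      (i + 1 ≠ 0 ∧ ((i + 1 : Fin n) : ℕ) = i + 1) := by
    have hi := i.isLt
    have hv : ((i + 1 : Fin n) : ℕ) = (i + 1) % n := by
      rw [Fin.val_add]; simp
    rcases (show (i : ℕ) + 1 = n ∨ (i : ℕ) + 1 < n by omega) with h | h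
    · left
      exact ⟨Fin.ext (by rw [hv, h]; simp), h⟩
    · right
      rw [Nat.mod_eq_of_lt h] at hv
      exact ⟨fun h0 => by rw [h0] at hv; simp at hv, hv⟩
  have key : Matrix.diagonal d * M.submatrix (Equiv.addRight 1) (Equiv.addRight 1) =
      M.map σ * Matrix.diagonal d := by
    ext i j
    rw [Matrix.diagonal_mul, Matrix.mul_diagonal]
    simp only [Matrix.submatrix_apply, Matrix.map_apply, Equiv.coe_addRight, M, cyclicCodeword,
      Matrix.of_apply, add_sub_add_right_eq_sub, map_mul, apply_ite σ, AlgEquiv.commutes, map_one,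
      d, ← AlgEquiv.mul_apply, ← pow_succ']
    have hpow : σ ^ ((i + 1 : Fin n) : ℕ) = σ ^ ((i : ℕ) + 1) := by
      rcases hwrap i with ⟨h0, h1⟩ | ⟨_, h1⟩
      · rw [h0, h1, hσ]; simp
      · rw [h1]
    rw [hpow]
    have hi := (i + 1).isLt
    have hj := (j + 1).isLt
    have hi' := i.isLt
    have hj' := j.isLt
    have hlt : (if i + 1 = 0 then algebraMap F K γ else 1) *
        (if j + 1 < i + 1 then algebraMap F K γ else 1) =
        (if j < i then algebraMap F K γ else 1) * (if j + 1 = 0 then algebraMap F K γ else 1) := by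
      rcases hwrap i with ⟨h0, h1⟩ | ⟨h0, h1⟩ <;> rcases hwrap j with ⟨h2, h3⟩ | ⟨h2, h3⟩ <;>
        simp only [h0, h2, Fin.lt_def, Fin.val_zero, if_true, if_false] <;>
        split_ifs <;> first | omega | simp
    linear_combination (σ ^ ((i : ℕ) + 1)) (x (j - i)) * hlt
  have h := congrArg Matrix.det key
  rw [Matrix.det_mul, Matrix.det_mul, Matrix.det_submatrix_equiv_self, mul_comm] at h
  have h' := mul_right_cancel₀ hd h
  exact (AlgEquiv.map_det σ M).trans h'.symm

theorem det_cyclicCodeword_const_mul (σ : K ≃ₐ[F] K) (γ : F) (a : K) (x : Fin n → K) :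
    (cyclicCodeword σ γ fun l => a * x l).det =
      (∏ i : Fin n, (σ ^ (i : ℕ)) a) * (cyclicCodeword σ γ x).det := by
  rw [← Matrix.det_mul_column]
  congr 1
  ext i j
  simp only [cyclicCodeword, Matrix.of_apply, map_mul]
  ring

theorem cyclicCodeword_single [NeZero n] (σ : K ≃ₐ[F] K) (γ : F) (a : K) :
    cyclicCodeword σ γ (Pi.single (0 : Fin n) a) =
      Matrix.diagonal fun i : Fin n => (σ ^ (i : ℕ)) a := by
  ext i j
  by_cases h : i = j
  · subst h
    simp [cyclicCodeword]
  · have : j - i ≠ 0 := fun h' => h (sub_eq_zero.mp h').symm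
    simp [cyclicCodeword, h, this]

theorem isIntegral_det_cyclicCodeword {σ : K ≃ₐ[F] K} {γ : F} (hγ : IsIntegral ℤ γ)
    {x : Fin n → K} (hx : ∀ l, IsIntegral ℤ (x l)) :
    IsIntegral ℤ (cyclicCodeword σ γ x).det := by
  refine IsIntegral.det fun i j => ?_
  simp only [cyclicCodeword, Matrix.of_apply]
  refine IsIntegral.mul ?_ (map_isIntegral_int _ (hx _))
  split_ifs
  · exact map_isIntegral_int (algebraMap F K) hγ
  · exact isIntegral_one

theorem det_cyclicCodeword_mem_range [FiniteDimensional F K] [IsGalois F K] [NeZero n]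
    (hn : Module.finrank F K = n) {σ : K ≃ₐ[F] K}
    (hσ : ∀ τ : K ≃ₐ[F] K, τ ∈ Subgroup.zpowers σ) {γ : F} (hγ : γ ≠ 0) (x : Fin n → K) :
    ∃ a : F, algebraMap F K a = (cyclicCodeword σ γ x).det := by
  have hσn : σ ^ n = 1 := hn ▸ CyclicAlgebra.pow_finrank_eq_one
  have hfix := map_det_cyclicCodeword hσn hγ x
  set y := (cyclicCodeword σ γ x).det
  refine IntermediateField.mem_bot.mp ((IsGalois.mem_bot_iff_fixed y).mpr fun τ => ?_)
  have hle : Subgroup.zpowers σ ≤ MulAction.stabilizer (K ≃ₐ[F] K) y := by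
    rw [Subgroup.zpowers_le]
    exact hfix
  exact hle (hσ τ)

/-- The powers of a generator enumerate the Galois group. -/
theorem bijective_pow_of_generator [FiniteDimensional F K] [IsGalois F K]
    (hn : Module.finrank F K = n) {σ : K ≃ₐ[F] K}
    (hσ : ∀ τ : K ≃ₐ[F] K, τ ∈ Subgroup.zpowers σ) :
    Function.Bijective fun i : Fin n => σ ^ (i : ℕ) := by
  have ho : orderOf σ = n := by
    rw [orderOf_eq_card_of_forall_mem_zpowers hσ, IsGalois.card_aut_eq_finrank, hn]
  refine (Fintype.bijective_iff_injective_and_card _).mpr ⟨fun i j h => ?_, ?_⟩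
  · exact Fin.ext (pow_injOn_Iio_orderOf (by simp [ho]) (by simp [ho]) h)
  · rw [Fintype.card_fin, ← Nat.card_eq_fintype_card, IsGalois.card_aut_eq_finrank, hn]

/-- The trace is the sum over the powers of `σ`. Taking determinants turns the squared determinant
of conjugates into a relative discriminant. -/
theorem transpose_mul_conjugates [FiniteDimensional F K] [IsGalois F K]
    (hn : Module.finrank F K = n) {σ : K ≃ₐ[F] K}
    (hσ : ∀ τ : K ≃ₐ[F] K, τ ∈ Subgroup.zpowers σ) (b : Fin n → K) :
    (Matrix.of fun i k : Fin n => (σ ^ (i : ℕ)) (b k))ᵀ *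
        (Matrix.of fun i k : Fin n => (σ ^ (i : ℕ)) (b k)) =
      (Algebra.traceMatrix F b).map (algebraMap F K) := by
  ext k l
  rw [Matrix.mul_apply, Matrix.map_apply, Algebra.traceMatrix_apply, Algebra.traceForm_apply,
    trace_eq_sum_automorphisms, ← (bijective_pow_of_generator hn hσ).sum_comp]
  simp

end CyclicCodeword

/-! ### Absolute values of integers of `ℚ(i)` and `ℚ(j)`. -/

section QuadraticIntegers

/-- Both generators have norm 1; only the trace `t` differs (`0` for `i`, `-1` for `j`), which
allows a uniform treatment. -/
theorem exists_trace_of_eq_I_or_exp {w : ℂ}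
    (hw : w = Complex.I ∨ w = Complex.exp (2 * Real.pi * Complex.I / 3)) :
    ∃ t : ℚ, w * w = t * w - 1 ∧ starRingEnd ℂ w = t - w := by
  rcases hw with rfl | rfl
  · exact ⟨0, by simp, by simp⟩
  · set w := Complex.exp (2 * Real.pi * Complex.I / 3) with hw
    have hprim : IsPrimitiveRoot w 3 := by
      simpa using Complex.isPrimitiveRoot_exp 3 (by norm_num)
    have h3 : w ^ 3 = 1 := hprim.pow_eq_one
    have h1 : w ≠ 1 := hprim.ne_one (by norm_num)
    have hsum : w * w + w + 1 = 0 := by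
      refine (mul_eq_zero.mp (?_ : (w - 1) * (w * w + w + 1) = 0)).resolve_left
        (sub_ne_zero.mpr h1)
      linear_combination h3
    have hnorm : w * starRingEnd ℂ w = 1 := by
      rw [Complex.mul_conj, Complex.normSq_eq_norm_sq, hprim.norm'_eq_one (by norm_num)]
      simp
    refine ⟨-1, by push_cast; linear_combination hsum, ?_⟩
    have hw0 : w ≠ 0 := Complex.exp_ne_zero _
    apply mul_left_cancel₀ hw0
    push_cast
    linear_combination hnorm + hsum

theorem exists_rat_add_rat_mul_of_mem_adjoin {w : ℂ} {t : ℚ} (hw : w * w = t * w - 1) {z : ℂ}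
    (hz : z ∈ Algebra.adjoin ℚ {w}) : ∃ p q : ℚ, z = p + q * w := by
  induction hz using Algebra.adjoin_induction with
  | mem x hx => exact ⟨0, 1, by simp_all⟩
  | algebraMap r => exact ⟨r, 0, by simp⟩
  | add x y _ _ hx hy =>
    obtain ⟨p, q, rfl⟩ := hx
    obtain ⟨p', q', rfl⟩ := hy
    exact ⟨p + p', q + q', by push_cast; ring⟩
  | mul x y _ _ hx hy =>
    obtain ⟨p, q, rfl⟩ := hx
    obtain ⟨p', q', rfl⟩ := hy
    refine ⟨p * p' - q * q', p * q' + q * p' + q * q' * t, ?_⟩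
    push_cast
    linear_combination (q * q' : ℂ) * hw

/-- A nonzero algebraic integer of `ℚ(i)` or `ℚ(j)` has absolute value at least one. -/
theorem one_le_norm_of_isIntegral_of_mem_adjoin {w : ℂ}
    (hw : w = Complex.I ∨ w = Complex.exp (2 * Real.pi * Complex.I / 3)) {z : ℂ}
    (hz : z ∈ Algebra.adjoin ℚ {w}) (hint : IsIntegral ℤ z) (h0 : z ≠ 0) : 1 ≤ ‖z‖ := by
  obtain ⟨t, hmul, hconj⟩ := exists_trace_of_eq_I_or_exp hw
  obtain ⟨p, q, hpq⟩ := exists_rat_add_rat_mul_of_mem_adjoin hmul hz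
  -- The norm `z z̄` is rational and integral, hence a positive integer.
  have hr : z * starRingEnd ℂ z = ((p * p + p * q * t + q * q : ℚ) : ℂ) := by
    rw [hpq]
    simp only [map_add, map_mul, hconj, map_ratCast]
    push_cast
    linear_combination (-(q * q) : ℂ) * hmul
  have hri : IsIntegral ℤ (((p * p + p * q * t + q * q : ℚ)) : ℂ) :=
    hr ▸ hint.mul (map_isIntegral_int (starRingEnd ℂ) hint)
  obtain ⟨m, hm⟩ := IsIntegrallyClosed.isIntegral_iff.mp
    ((isIntegral_algebraMap_iff (B := ℂ) (algebraMap ℚ ℂ).injective).mp hri)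
  rw [← hm, Complex.mul_conj, Complex.normSq_eq_norm_sq] at hr
  have hr' : ‖z‖ ^ 2 = (m : ℝ) := by
    simp only [eq_intCast, Rat.cast_intCast] at hr
    exact_mod_cast hr
  have hpos : 0 < ‖z‖ ^ 2 := by positivity
  have hm1 : (1 : ℝ) ≤ m := by
    rw [hr'] at hpos
    exact_mod_cast Int.cast_pos.mp hpos
  nlinarith [norm_nonneg z]

end QuadraticIntegers

/-! ### Relative integral bases and discriminants. -/

section IntegralBasis

variable {K : Type*} [Field K] [NumberField K] {n : ℕ}

theorem NumberField.discr_pos_of_isTotallyReal (L : Type*) [Field L] [NumberField L]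
    [NumberField.IsTotallyReal L] : 0 < NumberField.discr L := by
  rw [← Int.sign_eq_one_iff_pos, NumberField.sign_discr,
    NumberField.nrComplexPlaces_eq_zero_iff.mpr inferInstance, pow_zero]

/-- For a compositum `K` of linearly disjoint fields `E₁` and `E₂` with coprime discriminants,
an integral basis of `E₂` is a relative integral basis of `K / E₁`. -/
theorem exists_basis_det_conjugates_sq (E₁ E₂ : IntermediateField ℚ K)
    (hdisj : E₁.LinearDisjoint E₂) (hsup : E₁ ⊔ E₂ = ⊤)
    (hdisc : IsCoprime (NumberField.discr E₁) (NumberField.discr E₂))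
    (hE₂ : Module.finrank ℚ E₂ = n) [IsGalois E₁ K] (hn : Module.finrank E₁ K = n)
    {σ : K ≃ₐ[E₁] K} (hσ : ∀ τ : K ≃ₐ[E₁] K, τ ∈ Subgroup.zpowers σ) :
    ∃ b : Module.Basis (Fin n) (𝓞 E₁) (𝓞 K),
      (Matrix.of fun i k : Fin n => (σ ^ (i : ℕ)) (b k : K)).det ^ 2 = (NumberField.discr E₂ : K) := by
  classical
  let b₀ : Module.Basis (Fin n) ℤ (𝓞 E₂) :=
    Module.finBasisOfFinrankEq ℤ (𝓞 E₂) (by rw [NumberField.RingOfIntegers.rank, hE₂])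
  have hsup' : E₁.toSubalgebra ⊔ E₂.toSubalgebra = ⊤ := by
    simp [← IntermediateField.sup_toSubalgebra_of_left, hsup]
  let b : Module.Basis (Fin n) (𝓞 E₁) (𝓞 K) :=
    b₀.ofIsCoprimeDifferentIdeal ℤ (𝓞 K) (𝓞 E₁) (𝓞 E₂) hdisj hsup'
      (NumberField.isCoprime_differentIdeal_of_isCoprime_discr _ hdisc)
  have hb (k : Fin n) : (b k : K) = algebraMap E₂ K (b₀ k : E₂) := by
    have := b₀.ofIsCoprimeDifferentIdeal_apply ℤ (𝓞 K) (𝓞 E₁) (𝓞 E₂) hdisj hsup'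
      (NumberField.isCoprime_differentIdeal_of_isCoprime_discr _ hdisc) k
    exact congrArg (algebraMap (𝓞 K) K) this
  refine ⟨b, ?_⟩
  -- By linear disjointness, the trace of `K / E₁` restricts on `E₂` to the absolute trace.
  have htr : Algebra.traceMatrix E₁ (fun k => (b k : K)) =
      (Algebra.traceMatrix ℚ (fun k => (b₀ k : E₂))).map (algebraMap ℚ E₁) := by
    ext k l : 1
    rw [Matrix.map_apply, Algebra.traceMatrix_apply, Algebra.traceMatrix_apply,
      Algebra.traceForm_apply, Algebra.traceForm_apply, hb, hb, ← map_mul,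
      hdisj.trace_algebraMap hsup]
    congr!
  have hdiscr : (Algebra.traceMatrix ℚ (fun k => (b₀ k : E₂))).det = (NumberField.discr E₂ : ℚ) := by
    rw [← Algebra.discr_def, ← NumberField.discr_eq_discr E₂ b₀]
    have : Algebra.discr ℚ (b₀.localizationLocalization ℚ (nonZeroDivisors ℤ) E₂) =
        algebraMap ℤ ℚ (Algebra.discr ℤ b₀) :=
      Algebra.discr_localizationLocalization ℤ _ E₂ b₀
    rw [eq_intCast] at this
    rw [← this]
    congr 1
    ext k
    simp
  have h := congrArg Matrix.det (transpose_mul_conjugates hn hσ fun k => (b k : K))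
  rw [Matrix.det_mul, Matrix.det_transpose, ← sq] at h
  rw [h, htr, Matrix.map_map]
  have := RingHom.map_det ((algebraMap E₁ K).comp (algebraMap ℚ E₁))
    (Algebra.traceMatrix ℚ (fun k => (b₀ k : E₂)))
  rw [hdiscr, map_intCast] at this
  exact this.symm

end IntegralBasis

/-! ### Lower bounds for `𝓞 F` and for the symbol ring. -/

section Codes

variable {K : Type*} [Field K] [NumberField K]

theorem one_le_norm_map_of_isIntegral {ι : K →+* ℂ} {ω : K}
    (hω : ι ω = Complex.I ∨ ι ω = Complex.exp (2 * Real.pi * Complex.I / 3)) (a : ℚ⟮ω⟯)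
    (ha : IsIntegral ℤ a) (h0 : a ≠ 0) : 1 ≤ ‖ι a‖ := by
  refine one_le_norm_of_isIntegral_of_mem_adjoin hω ?_
    (map_isIntegral_int (ι.comp (algebraMap ℚ⟮ω⟯ K)) ha) (by simpa using h0)
  have hmem : (a : K) ∈ Algebra.adjoin ℚ {ω} := by
    rw [← IntermediateField.adjoin_simple_toSubalgebra_of_isAlgebraic
      (Algebra.IsAlgebraic.isAlgebraic ω)]
    exact a.2
  have h : ι.toRatAlgHom (a : K) ∈ (Algebra.adjoin ℚ {ω}).map ι.toRatAlgHom :=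
    Subalgebra.mem_map.mpr ⟨_, hmem, rfl⟩
  rw [AlgHom.map_adjoin, Set.image_singleton] at h
  exact h

/-- Handles determinants of symbol matrices; elements of `ℤ[w]` are integral, so `ℤ[w]` need not be
identified with `𝓞 F`. -/
theorem one_le_norm_of_mem_adjoin_int {w : ℂ}
    (hw : w = Complex.I ∨ w = Complex.exp (2 * Real.pi * Complex.I / 3)) {z : ℂ}
    (hz : z ∈ Algebra.adjoin ℤ {w}) (h0 : z ≠ 0) : 1 ≤ ‖z‖ := by
  have hwi : IsIntegral ℤ w := by
    rcases hw with rfl | rfl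
    · exact Complex.isIntegral_int_I
    · have h : IsPrimitiveRoot (Complex.exp (2 * Real.pi * Complex.I / 3)) 3 := by
        simpa using Complex.isPrimitiveRoot_exp 3 (by norm_num)
      exact h.isIntegral (by norm_num)
  refine one_le_norm_of_isIntegral_of_mem_adjoin hw ?_ ?_ h0
  · have hle : Algebra.adjoin ℤ {w} ≤ (Algebra.adjoin ℚ {w}).restrictScalars ℤ :=
      Algebra.adjoin_le Algebra.subset_adjoin
    exact hle hz
  · exact adjoin_le_integralClosure hwi hz

end Codes

/-! ### The main layer as a lattice of conjugates. -/

section Codes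

variable {F K : Type*} [Field F] [Field K] [Algebra F K] {n : ℕ}

theorem layeredEncode_diag [NeZero n] (R : Fin n → Matrix (Fin n) (Fin n) ℂ)
    (u : Fin n → Fin n → ℂ) (i : Fin n) : layeredEncode R u i i = (R 0 *ᵥ u 0) i := by
  simp [layeredEncode]

theorem cyclicCodeword_diag [NeZero n] (σ : K ≃ₐ[F] K) (γ : F) (x : Fin n → K) (i : Fin n) :
    cyclicCodeword σ γ x i i = (σ ^ (i : ℕ)) (x 0) := by
  simp [cyclicCodeword]

variable {Λ : Subalgebra ℤ ℂ} {ι : K →+* ℂ} {σ : K ≃ₐ[F] K} {γ : F} {I : Ideal (𝓞 K)} {c : ℝ}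
  {R : Fin n → Matrix (Fin n) (Fin n) ℂ}

/-- The columns of the matrix of the main layer are the conjugates of elements of the ideal. -/
theorem exists_columns_of_subset_cyclicCode [NeZero n]
    (hC : cyclicCode n ι σ γ I c =
      {X | ∃ u : Fin n → Fin n → ℂ, (∀ l k, u l k ∈ (Λ : Set ℂ)) ∧ X = layeredEncode R u}) :
    ∃ ν : Fin n → 𝓞 K, (∀ k, ν k ∈ I) ∧
      R 0 = ((1 / Real.sqrt c : ℝ) : ℂ) •
        (Matrix.of fun i k : Fin n => (σ ^ (i : ℕ)) (ν k : K)).map ι := by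
  have key (k : Fin n) : ∃ y ∈ I, ∀ i : Fin n,
      R 0 i k = ((1 / Real.sqrt c : ℝ) : ℂ) * ι ((σ ^ (i : ℕ)) (y : K)) := by
    -- A single symbol `1` at place `k` of layer `0` puts column `k` of `R 0` on the diagonal.
    let u : Fin n → Fin n → ℂ := Pi.single 0 (Pi.single k 1)
    have hu : ∀ l m, u l m ∈ (Λ : Set ℂ) := by
      intro l m
      by_cases hl : l = 0
      · subst hl
        by_cases hm : m = k
        · subst hm
          simp only [u, Pi.single_eq_same]
          exact Λ.one_mem
        · simp only [u, Pi.single_eq_same, Pi.single_eq_of_ne hm]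
          exact Λ.zero_mem
      · simp only [u, Pi.single_eq_of_ne hl]
        exact Λ.zero_mem
    have hmem : layeredEncode R u ∈ cyclicCode n ι σ γ I c := hC ▸ ⟨u, hu, rfl⟩
    obtain ⟨x, hx, hX⟩ := hmem
    refine ⟨x 0, hx 0, fun i => ?_⟩
    have h := congrFun (congrFun hX i) i
    rw [layeredEncode_diag, Matrix.smul_apply, Matrix.map_apply, cyclicCodeword_diag] at h
    simpa [u] using h
  choose ν hν hR using key
  exact ⟨ν, hν, by ext i k; simp [hR]⟩

/-- The conjugates of elements of the ideal are encoded by the matrix of the main layer. -/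
theorem exists_symbols_of_cyclicCode_subset [NeZero n]
    (hC : cyclicCode n ι σ γ I c =
      {X | ∃ u : Fin n → Fin n → ℂ, (∀ l k, u l k ∈ (Λ : Set ℂ)) ∧ X = layeredEncode R u})
    (ν : Fin n → 𝓞 K) (hν : ∀ k, ν k ∈ I) :
    ∃ U : Matrix (Fin n) (Fin n) ℂ, (∀ i k, U i k ∈ Λ) ∧
      ((1 / Real.sqrt c : ℝ) : ℂ) •
        (Matrix.of fun i k : Fin n => (σ ^ (i : ℕ)) (ν k : K)).map ι = R 0 * U := by
  have key (k : Fin n) : ∃ v : Fin n → ℂ, (∀ m, v m ∈ Λ) ∧ ∀ i : Fin n,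
      ((1 / Real.sqrt c : ℝ) : ℂ) * ι ((σ ^ (i : ℕ)) (ν k : K)) = (R 0 *ᵥ v) i := by
    -- Only the diagonal is read off, so just the value `x 0 = ν k` matters.
    let x : Fin n → 𝓞 K := fun _ => ν k
    have hmem : ((1 / Real.sqrt c : ℝ) : ℂ) • (cyclicCodeword σ γ fun l => (x l : K)).map ι ∈
        cyclicCode n ι σ γ I c := ⟨x, fun _ => hν k, rfl⟩
    rw [hC] at hmem
    obtain ⟨u, hu, hX⟩ := hmem
    refine ⟨u 0, hu 0, fun i => ?_⟩
    have h := congrFun (congrFun hX i) i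
    rw [layeredEncode_diag, Matrix.smul_apply, Matrix.map_apply, cyclicCodeword_diag] at h
    simpa using h
  choose v hv hR using key
  refine ⟨Matrix.of fun m k => v k m, fun i k => hv k i, ?_⟩
  ext i k
  simp only [Matrix.smul_apply, Matrix.map_apply, Matrix.of_apply, smul_eq_mul, hR,
    Matrix.mul_apply, Matrix.mulVec, dotProduct]

theorem Subalgebra.det_mem {A B : Type*} [CommRing A] [CommRing B] [Algebra A B]
    (S : Subalgebra A B) {U : Matrix (Fin n) (Fin n) B} (hU : ∀ i j, U i j ∈ S) : U.det ∈ S := by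
  rw [Matrix.det_apply]
  exact S.sum_mem fun τ _ => by
    rw [Units.smul_def]
    exact S.toSubring.zsmul_mem (S.prod_mem fun i _ => hU _ _) _

end Codes

/-! ### The constant forced by shaping. -/

section Normalization

variable {K : Type*} [Field K] [NumberField K] {n : ℕ}

/-- The normalisation forced by the shaping property. -/
theorem normalization_of_unitary [NeZero n] {ι : K →+* ℂ} {ω : K}
    (hω : ι ω = Complex.I ∨ ι ω = Complex.exp (2 * Real.pi * Complex.I / 3))
    {σ : K ≃ₐ[ℚ⟮ω⟯] K} {γ : ℚ⟮ω⟯} {α : 𝓞 K} {c : ℝ} {R : Fin n → Matrix (Fin n) (Fin n) ℂ}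
    (hC : cyclicCode n ι σ γ (Ideal.span {α}) c =
      {X | ∃ u : Fin n → Fin n → ℂ, (∀ l k, u l k ∈ (Algebra.adjoin ℤ {ι ω} : Set ℂ)) ∧
        X = layeredEncode R u})
    (hR : R 0 ∈ Matrix.unitaryGroup (Fin n) ℂ) (b : Module.Basis (Fin n) (𝓞 ℚ⟮ω⟯) (𝓞 K)) {d : ℤ}
    (hb : (Matrix.of fun i k : Fin n => (σ ^ (i : ℕ)) (b k : K)).det ^ 2 = (d : K)) :
    ‖((1 / Real.sqrt c : ℝ) : ℂ) ^ n * ι (∏ i : Fin n, (σ ^ (i : ℕ)) (α : K))‖ ^ 2 * |(d : ℝ)| =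
      1 := by
  set s : ℂ := ((1 / Real.sqrt c : ℝ) : ℂ)
  set V : Matrix (Fin n) (Fin n) K := Matrix.of fun i k => (σ ^ (i : ℕ)) (b k : K)
  set N : K := ∏ i : Fin n, (σ ^ (i : ℕ)) (α : K)
  have hR1 : ‖(R 0).det‖ = 1 := by
    have := Matrix.det_of_mem_unitary hR
    exact CStarRing.norm_of_mem_unitary this
  -- the conjugates of the basis `α b` of the ideal
  let W : Matrix (Fin n) (Fin n) K := Matrix.of fun i k => (σ ^ (i : ℕ)) ((α * b k : 𝓞 K) : K)
  have hWV : W.det = N * V.det := by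
    rw [← Matrix.det_mul_column]
    congr 1
    ext i k
    simp [W, V]
  have hsW : (s • W.map ι).det = s ^ n * ι N * ι V.det := by
    rw [Matrix.det_smul, Fintype.card_fin, mul_assoc, ← map_mul, ← hWV, RingHom.map_det]
    rfl
  obtain ⟨ν, hν, hR0⟩ := exists_columns_of_subset_cyclicCode hC
  obtain ⟨U, hU, hWU⟩ := exists_symbols_of_cyclicCode_subset hC (fun k => α * b k)
    fun k => Ideal.mul_mem_right _ _ (Ideal.mem_span_singleton_self α)
  replace hWU : s • W.map ι = R 0 * U := hWU
  choose y hy using fun k => Ideal.mem_span_singleton'.mp (hν k)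
  -- Since `ν k = y k * α`, the coordinates of `y k` in `b` express column `k` of `R 0` in the
  -- conjugates of `α b`.
  let P : Matrix (Fin n) (Fin n) (𝓞 ℚ⟮ω⟯) := Matrix.of fun m k => b.repr (y k) m
  have hWP : R 0 = s • W.map ι * P.map (ι.comp ((algebraMap ℚ⟮ω⟯ K).comp
      (algebraMap (𝓞 ℚ⟮ω⟯) ℚ⟮ω⟯))) := by
    rw [hR0, Matrix.smul_mul]
    congr 1
    ext i k
    have hνk : (ν k : K) = ∑ m, (algebraMap ℚ⟮ω⟯ K (P m k : ℚ⟮ω⟯)) * ((α * b m : 𝓞 K) : K) := by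
      rw [← hy k]
      conv_lhs => rw [← b.sum_repr (y k)]
      rw [Finset.sum_mul]
      refine (map_sum (algebraMap (𝓞 K) K) _ _).trans (Finset.sum_congr rfl fun m _ => ?_)
      rw [Algebra.smul_def, mul_assoc, mul_comm (b m)]
      exact map_mul (algebraMap (𝓞 K) K) _ _
    simp only [Matrix.mul_apply, Matrix.map_apply, Matrix.of_apply, hνk, W, map_sum, map_mul,
      AlgEquiv.commutes, RingHom.comp_apply]
    exact Finset.sum_congr rfl fun m _ => mul_comm _ _
  have h1 := congrArg (fun M => ‖Matrix.det M‖) hWU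
  have h2 := congrArg (fun M => ‖Matrix.det M‖) hWP
  simp only [Matrix.det_mul, norm_mul, hR1, hsW, one_mul] at h1 h2
  have hPdet : (P.map (ι.comp ((algebraMap ℚ⟮ω⟯ K).comp (algebraMap (𝓞 ℚ⟮ω⟯) ℚ⟮ω⟯)))).det =
      ι ((P.det : ℚ⟮ω⟯) : K) :=
    (RingHom.map_det (ι.comp ((algebraMap ℚ⟮ω⟯ K).comp (algebraMap (𝓞 ℚ⟮ω⟯) ℚ⟮ω⟯))) P).symm
  rw [hPdet] at h2
  have hU1 : 1 ≤ ‖U.det‖ := by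
    refine one_le_norm_of_mem_adjoin_int hω (Subalgebra.det_mem _ hU) fun h0 => ?_
    rw [h0, norm_zero] at h1
    rw [h1, zero_mul] at h2
    exact one_ne_zero h2
  have hP1 : 1 ≤ ‖ι ((P.det : ℚ⟮ω⟯) : K)‖ := by
    refine one_le_norm_map_of_isIntegral hω _ P.det.isIntegral_coe fun h0 => ?_
    rw [h0] at h2
    simp at h2
  -- The left side equals `‖det U‖ ≥ 1`, and its product with `‖det P‖ ≥ 1` is `1`.
  have h3 : ‖s ^ n‖ * ‖ι N‖ * ‖ι V.det‖ = 1 := by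
    nlinarith [norm_nonneg U.det]
  have hVd : ‖ι V.det‖ ^ 2 = |(d : ℝ)| := by
    rw [← norm_pow, ← map_pow, hb, map_intCast, Complex.norm_intCast]
  rw [← hVd, norm_mul, ← mul_pow, h3, one_pow]

end Normalization

/-! ### The minimum determinant. -/

theorem mainTheorem6 {K : Type*} [Field K] [NumberField K] (ι : K →+* ℂ) (ω θ : K) (n : ℕ)
    -- `F = ℚ⟮ω⟯` is `ℚ(i)` or `ℚ(j)`, and `K` is the compositum of `F` and `ℚ⟮θ⟯`
    (hω : ι ω = Complex.I ∨ ι ω = Complex.exp (2 * Real.pi * Complex.I / 3))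
    (hK : ℚ⟮ω⟯ ⊔ ℚ⟮θ⟯ = ⊤)
    -- `ℚ⟮θ⟯` is a totally real Galois field of degree `n` with discriminant prime to that of `F`
    [NumberField.IsTotallyReal ℚ⟮θ⟯] [IsGalois ℚ ℚ⟮θ⟯]
    (hθ : Module.finrank ℚ ℚ⟮θ⟯ = n)
    (hdisc : IsCoprime (NumberField.discr ℚ⟮ω⟯) (NumberField.discr ℚ⟮θ⟯))
    -- `K / F` is cyclic of degree `n` with Galois group generated by `σ`
    [IsGalois ℚ⟮ω⟯ K] (hn : Module.finrank ℚ⟮ω⟯ K = n)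
    (σ : K ≃ₐ[ℚ⟮ω⟯] K) (hσ : ∀ τ : K ≃ₐ[ℚ⟮ω⟯] K, τ ∈ Subgroup.zpowers σ)
    -- `γ` is a nonzero element of the ring of integers of `F`
    (γ : ℚ⟮ω⟯) (hγ : γ ≠ 0) (hγ_int : IsIntegral ℤ γ)
    -- the cyclic algebra `(K/F, σ, γ)` is a division algebra
    (hdiv : ∀ x : CyclicAlgebra σ γ, x ≠ 0 → IsUnit x)
    (I : Ideal (𝓞 K)) (hI : I.IsPrincipal) (c : ℝ) (hc : 0 < c)
    (hperfect : IsPerfectCode (Algebra.adjoin ℤ {ι ω} : Set ℂ) (cyclicCode n ι σ γ I c)) :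
    IsLeast (codeDetValues (cyclicCode n ι σ γ I c)) (1 / (NumberField.discr ℚ⟮θ⟯ : ℝ)) ∧
      minDeterminant (cyclicCode n ι σ γ I c) = 1 / (NumberField.discr ℚ⟮θ⟯ : ℝ) := by
  subst hn
  have : NeZero (Module.finrank ℚ⟮ω⟯ K) := ⟨Module.finrank_pos.ne'⟩
  have hdpos : (0 : ℝ) < NumberField.discr ℚ⟮θ⟯ := by
    exact_mod_cast NumberField.discr_pos_of_isTotallyReal ℚ⟮θ⟯
  have hdisj : (ℚ⟮ω⟯).LinearDisjoint ℚ⟮θ⟯ :=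
    ((IntermediateField.linearDisjoint_comm).mp
      (NumberField.linearDisjoint_of_isGalois_isCoprime_discr K ℚ⟮θ⟯ ℚ⟮ω⟯ hdisc.symm))
  obtain ⟨b, hb⟩ := exists_basis_det_conjugates_sq ℚ⟮ω⟯ ℚ⟮θ⟯ hdisj hK hdisc hθ rfl hσ
  obtain ⟨α, rfl⟩ := hI
  obtain ⟨R, hC, -, hR, -⟩ := hperfect
  have hnorm := normalization_of_unitary hω hC (hR 0) b hb
  rw [abs_of_pos hdpos] at hnorm
  set s : ℂ := ((1 / Real.sqrt c : ℝ) : ℂ)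
  set n := Module.finrank ℚ⟮ω⟯ K
  set N : K := ∏ i : Fin n, (σ ^ (i : ℕ)) (α : K)
  have hdet (M : Matrix (Fin n) (Fin n) K) : (s • M.map ι).det = s ^ n * ι M.det := by
    rw [Matrix.det_smul, Fintype.card_fin, RingHom.map_det]
    rfl
  have hnorm' : ‖s ^ n * ι N‖ ^ 2 = 1 / (NumberField.discr ℚ⟮θ⟯ : ℝ) :=
    eq_one_div_of_mul_eq_one_left hnorm
  have hleast : IsLeast (codeDetValues (cyclicCode n ι σ γ (Ideal.span {α}) c))
      (1 / (NumberField.discr ℚ⟮θ⟯ : ℝ)) := by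
    refine ⟨⟨s • (cyclicCodeword σ γ fun l =>
        ((Pi.single (0 : Fin n) α : Fin n → 𝓞 K) l : K)).map ι, ⟨_, fun l => ?_, rfl⟩, ?_⟩, ?_⟩
    · by_cases hl : l = 0
      · subst hl
        simp
      · simp [Pi.single_eq_of_ne hl]
    · have hsingle : (fun l => ((Pi.single (0 : Fin n) α : Fin n → 𝓞 K) l : K)) =
          Pi.single (0 : Fin n) (α : K) := by
        ext l
        by_cases hl : l = 0
        · subst hl; simp
        · simp [Pi.single_eq_of_ne hl]
      have hdetX : (s • (cyclicCodeword σ γ fun l =>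
          ((Pi.single (0 : Fin n) α : Fin n → 𝓞 K) l : K)).map ι).det = s ^ n * ι N := by
        rw [hdet, hsingle, cyclicCodeword_single, Matrix.det_diagonal]
      -- If this codeword vanished, `hnorm` would read `0 = 1`.
      refine ⟨fun h0 => ?_, by rw [hdetX, hnorm']⟩
      rw [← hdetX, h0, Matrix.det_zero] at hnorm
      simp at hnorm
    · rintro r ⟨X, ⟨x, hx, rfl⟩, hX0, rfl⟩
      choose y hy using fun l => Ideal.mem_span_singleton'.mp (hx l)
      have hxy : (fun l => (x l : K)) = fun l => (α : K) * (y l : K) := by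
        ext l
        rw [← hy l, mul_comm]
        exact map_mul (algebraMap (𝓞 K) K) _ _
      set z : K := (cyclicCodeword σ γ fun l => (y l : K)).det
      have hy0 : (fun l => (y l : K)) ≠ 0 := by
        intro h0
        apply hX0
        have : (fun l => (x l : K)) = 0 := by
          rw [hxy]
          ext l
          rw [show (y l : K) = 0 from congrFun h0 l, mul_zero]
          rfl
        rw [this]
        ext i j
        simp [cyclicCodeword]
      have hz0 : z ≠ 0 :=
        det_cyclicCodeword_ne_zero (x := (fun l => (y l : K) : CyclicAlgebra σ γ)) (hdiv _ hy0)
      have hzint : IsIntegral ℤ z :=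
        isIntegral_det_cyclicCodeword hγ_int fun l => (y l).isIntegral_coe
      obtain ⟨a, ha⟩ := det_cyclicCodeword_mem_range rfl hσ hγ fun l => (y l : K)
      have ha : algebraMap ℚ⟮ω⟯ K a = z := ha
      -- `z` descends to a nonzero integer `a` of `F`, so the factor it contributes to `|det X|²` is
      -- at least 1.
      have hz1 : 1 ≤ ‖ι z‖ := by
        rw [← ha]
        refine one_le_norm_map_of_isIntegral hω a ?_ ?_
        · exact (isIntegral_algebraMap_iff (algebraMap ℚ⟮ω⟯ K).injective).mp (ha ▸ hzint)
        · rintro rfl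
          exact hz0 (by rw [← ha, map_zero])
      rw [hdet, hxy, det_cyclicCodeword_const_mul, map_mul, ← mul_assoc, norm_mul, mul_pow,
        hnorm']
      exact le_mul_of_one_le_right (by positivity) (one_le_pow₀ hz1)
  exact ⟨hleast, hleast.csInf_eq⟩
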